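/- **Model.** A *stream* is a finite sequence of closed intervals $[a,b]\subset\mathbb R$ ($a\le b$, repetitions allowed); its *Klee's measure* is the Lebesgue measure of the union of its intervals. A *randomized one-pass streaming algorithm using $s$ bits of space* has a memory with contents in $\{0,1\}^s$: a random initial memory, for each memory content and each interval read a probability distribution of the next memory content, and for each memory content at the end of the stream a probability distribution on $\mathbb R$ for the answer. Fresh random coins may be tossed at every step, but coins are private (whatever is to be remembered, random choices included, must be kept in the $s$ bits); time is not restricted, and the algorithm may depend on all the parameters below. For a set $U\subseteq\mathbb R$, it gives an *$(\epsilon,\rho)$-additive solution to Klee's measure for all streams of at most $k$ intervals with coordinates in $U$* if, on each stream of at most $k$ intervals whose endpoints lie in $U$, its answer differs from Klee's measure of the stream by at most $\epsilon$ with probability at least $1-\rho$. **Theorem.** For every fixed $\rho\in[0,\tfrac12)$ there is a constant $c>0$, depending only on $\rho$, such that the following holds. For every $\epsilon\in(0,0.1)$ there is a positive integer $n_0\le\frac1{2\epsilon}$ such that for every integer $n\ge n_0$ and every $U\subseteq\mathbb R$ containing $0,\frac1n,\frac2n,\dots,1$, each randomized one-pass streaming algorithm that gives an $(\epsilon,\rho)$-additive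 solution to Klee's measure for all streams of at most $2n$ intervals with coordinates in $U$ uses at least $$c\left(\frac1\epsilon+\log_2 n\right)$$ bits of space, i.e. it uses $\Omega\!\left(\frac1\epsilon+\log n\right)$ bits. (The choice $U=\mathbb R$ gives all streams of at most $2n$ intervals in $\mathbb R$.) -/

import Mathlib

open MeasureTheory

namespace KleeStream

/-- A stream of closed intervals `[a, b]`, `a ≤ b`, of the real line; repetitions are allowed. -/
abbrev IntervalStream : Type := List (NonemptyInterval ℝ)

/-- The union of the intervals of a stream. -/
def covered (σ : IntervalStream) : Set ℝ :=
  ⋃ I ∈ σ, Set.Icc I.fst I.snd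

/-- Klee's measure on the line: the total length of the union of the intervals. -/
noncomputable def kleeMeasure (σ : IntervalStream) : ℝ :=
  volume.real (covered σ)

/-- All end points of the intervals of the stream are taken from the set `U` of coordinates. -/
def HasCoordsIn (σ : IntervalStream) (U : Set ℝ) : Prop :=
  ∀ I ∈ σ, I.fst ∈ U ∧ I.snd ∈ U

/-- The contents of a working memory of `s` bits. -/
abbrev Memory (s : ℕ) : Type := Fin s → Bool

/-- A randomized one-pass streaming algorithm with `s` bits of memory, reading intervals and
answering with a real number.  The memory is all that is kept between two items of the stream.
Every step may use fresh coins, and the law of its result depends only on the current memory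
and the current item (private coins: a random choice that is needed again must be stored).
Nothing is assumed on the computational cost of a step. -/
structure StreamAlg (s : ℕ) where
  /-- law of the initial memory contents -/
  init : PMF (Memory s)
  /-- law of the new memory contents after an item has been read -/
  step : Memory s → NonemptyInterval ℝ → PMF (Memory s)
  /-- law of the answer given from the memory contents at the end of the stream -/
  answer : Memory s → ProbabilityMeasure ℝ

namespace StreamAlg

variable {s : ℕ}

/-- The law of the memory contents after the items of the stream were read, in order, once. -/
noncomputable def memoryLaw (A : StreamAlg s) (σ : IntervalStream) : PMF (Memory s) :=
  σ.foldl (fun μ I => μ.bind fun m => A.step m I) A.init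

/-- The law of the answer of the algorithm on a stream. -/
noncomputable def answerLaw (A : StreamAlg s) (σ : IntervalStream) : Measure ℝ :=
  ∑ m : Memory s, A.memoryLaw σ m • (A.answer m : Measure ℝ)

/-- On every stream of at most `k` intervals with coordinates in `U`, the answer is within `ε` of
Klee's measure with probability at least `1 - ρ`. -/
def IsAdditiveSolution (A : StreamAlg s) (ε ρ : ℝ) (k : ℕ) (U : Set ℝ) : Prop :=
  ∀ σ : IntervalStream, σ.length ≤ k → HasCoordsIn σ U →
    ENNReal.ofReal (1 - ρ) ≤ A.answerLaw σ {v : ℝ | |v - kleeMeasure σ| ≤ ε}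

end StreamAlg

end KleeStream

namespace KleeStream

open Finset

/-! ### Counting Boolean vectors with a large score -/

/-! Cutting a stream in two makes the memory a one-way message of `s` bits, and each summand comes
from a communication problem.

For `1 / ε`: a vector `x` selects among `N` blocks, each longer than `2 ε`, with `N` of order `1 /
ε`. Appending all blocks but the `j`-th makes the measure reveal `x j`, so every bit is recoverable
with probability `1 - ρ > 1/2`. `exp_le_card_of_recover` then makes `s` at least of order `N`.

For `log n`: take `n` blocks of length `1 / n`. If `x` and `y` differ in many places, appending the
blocks of one of them separates the measures by more than `2 ε`, so the memory laws after `x` and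
`y` are far apart (`exists_test`). Coins being private, the law on `2 ^ s` states is all that
survives. Up to rounding there are few such laws, whereas few colours force two very different
vectors to share one (`exp_le_of_distinguish`). Hence `n` is at most a constant times `4 ^ s`.

Both counts rest on Hoeffding's bound `card_score_ge_le`. -/

lemma exp_add_exp_le {l a b : ℝ} (hl : 0 ≤ l) (ha : 0 ≤ a) (hb : 0 ≤ b) (hab : a + b ≤ 1) :
    Real.exp (l * a) + Real.exp (l * b) ≤ 2 * Real.exp (l / 2 + l ^ 2 / 8) := by
  have h1 : Real.exp (l * a) + Real.exp (l * b)
      = Real.exp (l * (a + b) / 2) * (2 * Real.cosh (l * (a - b) / 2)) := by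
    rw [Real.cosh_eq, mul_div_cancel₀ _ (two_ne_zero), mul_add, ← Real.exp_add, ← Real.exp_add]
    ring_nf
  have h2 : Real.cosh (l * (a - b) / 2) ≤ Real.exp (l ^ 2 / 8) := by
    refine (Real.cosh_le_exp_half_sq _).trans (Real.exp_le_exp.2 ?_)
    have h3 : (a - b) ^ 2 ≤ 1 := by
      rw [sq_le_one_iff_abs_le_one, abs_le]
      constructor <;> linarith
    nlinarith [mul_le_mul_of_nonneg_left h3 (sq_nonneg l)]
  have h4 : Real.exp (l * (a + b) / 2) ≤ Real.exp (l / 2) :=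
    Real.exp_le_exp.2 (by nlinarith [mul_le_mul_of_nonneg_left hab hl])
  rw [h1, Real.exp_add]
  calc _ ≤ Real.exp (l / 2) * (2 * Real.exp (l ^ 2 / 8)) := by gcongr
    _ = _ := by ring

/-- Hoeffding's bound for the number of Boolean vectors whose score exceeds the mean. -/
lemma card_score_ge_le {N : ℕ} (p : Fin N → Bool → ℝ) (hp : ∀ j b, 0 ≤ p j b)
    (hp1 : ∀ j, p j true + p j false ≤ 1) {δ : ℝ} (hδ : 0 ≤ δ) :
    (#{x : Fin N → Bool | (1 / 2 + δ) * N ≤ ∑ j, p j (x j)} : ℝ)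
      ≤ 2 ^ N * Real.exp (-(2 * δ ^ 2 * N)) := by
  set F : Finset (Fin N → Bool) := {x | (1 / 2 + δ) * N ≤ ∑ j, p j (x j)} with hF
  -- Chernoff with parameter `l = 4 δ`, which minimizes the exponent `l ^ 2 / 8 - l * δ` per
  -- coordinate.
  have h1 : (#F : ℝ) * Real.exp (4 * δ * ((1 / 2 + δ) * N))
      ≤ ∑ x : Fin N → Bool, Real.exp (4 * δ * ∑ j, p j (x j)) := by
    rw [← nsmul_eq_mul]
    refine (card_nsmul_le_sum F _ _ fun x hx => ?_).trans
      (sum_le_univ_sum_of_nonneg fun x => (Real.exp_pos _).le)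
    have := (mem_filter.1 hx).2
    exact Real.exp_le_exp.2 (by gcongr)
  have h2 : ∑ x : Fin N → Bool, Real.exp (4 * δ * ∑ j, p j (x j))
      = ∏ j, ∑ b, Real.exp (4 * δ * p j b) := by
    rw [Fintype.prod_sum]
    exact sum_congr rfl fun x _ => by rw [mul_sum, Real.exp_sum]
  have h3 : ∏ j, ∑ b, Real.exp (4 * δ * p j b)
      ≤ (2 * Real.exp (4 * δ / 2 + (4 * δ) ^ 2 / 8)) ^ N := by
    refine (prod_le_prod (fun j _ => sum_nonneg fun b _ => (Real.exp_pos _).le)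
      (g := fun _ => 2 * Real.exp (4 * δ / 2 + (4 * δ) ^ 2 / 8)) fun j _ => ?_).trans_eq (by simp)
    rw [Fintype.sum_bool]
    exact exp_add_exp_le (by positivity) (hp _ _) (hp _ _) (hp1 j)
  rw [mul_pow, ← Real.exp_nat_mul] at h3
  have h4 := h1.trans (h2.trans_le h3)
  rw [← le_div_iff₀ (Real.exp_pos _), mul_div_assoc, ← Real.exp_sub] at h4
  refine h4.trans_eq ?_
  ring_nf

/-- Random access codes: if every bit of `x` can be recovered with probability `1/2 + δ` from a
random message that depends on `x`, then there are many messages. -/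
lemma exp_le_card_of_recover {N : ℕ} {M : Type*} [Fintype M] (P : (Fin N → Bool) → M → ℝ)
    (hP : ∀ x m, 0 ≤ P x m) (hP1 : ∀ x, ∑ m, P x m = 1) (h : M → Fin N → Bool → ℝ)
    (hh : ∀ m j b, 0 ≤ h m j b) (hh1 : ∀ m j, h m j true + h m j false ≤ 1) {δ : ℝ} (hδ : 0 ≤ δ)
    (hrec : ∀ x j, 1 / 2 + δ ≤ ∑ m, P x m * h m j (x j)) :
    Real.exp (2 * δ ^ 2 * N) ≤ Fintype.card M := by
  classical
  -- Some message does at least as well as the average, so the high-score sets of the messages cover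
  -- the cube; each is small by Hoeffding.
  have h1 : ∀ x : Fin N → Bool, ∃ m, (1 / 2 + δ) * N ≤ ∑ j, h m j (x j) := by
    intro x
    by_contra! hcon
    have h2 : (1 / 2 + δ) * N ≤ ∑ m, P x m * ∑ j, h m j (x j) := by
      simp_rw [mul_sum]
      rw [sum_comm]
      calc (1 / 2 + δ) * N = ∑ _j : Fin N, (1 / 2 + δ) := by simp; ring
        _ ≤ _ := sum_le_sum fun j _ => hrec x j
    obtain ⟨m, -, hm⟩ : ∃ m ∈ univ, 0 < P x m := by
      by_contra! hle
      have := sum_nonpos hle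
      rw [hP1] at this
      linarith
    have h3 : ∑ m, P x m * ∑ j, h m j (x j) < ∑ m, P x m * ((1 / 2 + δ) * N) :=
      sum_lt_sum (fun m _ => mul_le_mul_of_nonneg_left (hcon m).le (hP x m))
        ⟨m, mem_univ m, mul_lt_mul_of_pos_left (hcon m) hm⟩
    rw [← sum_mul, hP1, one_mul] at h3
    linarith
  have h2 : (2 : ℝ) ^ N ≤ ∑ m : M, 2 ^ N * Real.exp (-(2 * δ ^ 2 * N)) := by
    calc (2 : ℝ) ^ N = (#(univ : Finset (Fin N → Bool)) : ℝ) := by simp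
      _ ≤ (#((univ : Finset M).biUnion
            fun m => {x : Fin N → Bool | (1 / 2 + δ) * N ≤ ∑ j, h m j (x j)}) : ℝ) := by
          norm_cast
          refine card_le_card fun x _ => ?_
          simpa using h1 x
      _ ≤ ∑ m : M, (#{x : Fin N → Bool | (1 / 2 + δ) * N ≤ ∑ j, h m j (x j)} : ℝ) := by
          norm_cast
          exact card_biUnion_le
      _ ≤ _ := sum_le_sum fun m _ => card_score_ge_le (h m) (hh m) (hh1 m) hδ
  rw [sum_const, nsmul_eq_mul, card_univ, Real.exp_neg, ← div_eq_mul_inv, ← mul_div_assoc,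
    le_div_iff₀ (Real.exp_pos _), mul_comm] at h2
  exact le_of_mul_le_mul_right h2 (by positivity)

/-- If there are few colours, two Boolean vectors of the same colour have few agreements. -/
lemma exists_same_colour_few_agreements {n : ℕ} {κ : Type*} [Fintype κ]
    (f : (Fin n → Bool) → κ) {δ : ℝ} (hδ : 0 ≤ δ)
    (hκ : (Fintype.card κ : ℝ) < Real.exp (2 * δ ^ 2 * n)) :
    ∃ x y, f x = f y ∧ (#{j | x j = y j} : ℝ) < (1 / 2 + δ) * n := by
  classical
  by_contra! hcon
  -- By contradiction every vector of a colour class agrees often with a fixed member `y`; the score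
  -- counts these agreements.
  have hfib : ∀ c : κ, (#{x | f x = c} : ℝ) ≤ 2 ^ n * Real.exp (-(2 * δ ^ 2 * n)) := by
    intro c
    by_cases hc : ∃ y, f y = c
    · obtain ⟨y, rfl⟩ := hc
      refine le_trans ?_ (card_score_ge_le (fun j b => if b = y j then 1 else 0)
        (fun j b => by split_ifs <;> norm_num)
        (fun j => by cases y j <;> simp) hδ)
      norm_cast
      refine card_le_card fun x hx => ?_
      simp only [mem_filter, mem_univ, true_and] at hx ⊢
      refine (hcon x y hx).trans_eq ?_
      simp
    · have : ({x | f x = c} : Finset (Fin n → Bool)) = ∅ := by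
        ext x
        simpa using fun h => hc ⟨x, h⟩
      rw [this]
      simp only [card_empty, Nat.cast_zero]
      positivity
  have h2 : (2 : ℝ) ^ n ≤ ∑ c : κ, 2 ^ n * Real.exp (-(2 * δ ^ 2 * n)) := by
    calc (2 : ℝ) ^ n = (#(univ : Finset (Fin n → Bool)) : ℝ) := by simp
      _ = ∑ c : κ, (#{x | f x = c} : ℝ) := by
          norm_cast
          exact card_eq_sum_card_fiberwise (by simp)
      _ ≤ _ := sum_le_sum fun c _ => hfib c
  rw [sum_const, nsmul_eq_mul, card_univ, Real.exp_neg, ← div_eq_mul_inv, ← mul_div_assoc,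
    le_div_iff₀ (Real.exp_pos _), mul_comm] at h2
  exact absurd (le_of_mul_le_mul_right h2 (by positivity)) (not_le.2 hκ)

/-- Rounding probability vectors to a grid: if every two vectors with at most
`(1 / 2 + δ) * n` agreements are sent to probability vectors on `M` that some test with values
in `[0, 1]` tells apart with advantage `1 / L`, then `M` is large. -/
lemma exp_le_of_distinguish {n : ℕ} {M : Type*} [Fintype M] [Nonempty M]
    (P : (Fin n → Bool) → M → ℝ) (hP : ∀ x m, 0 ≤ P x m) (hP1 : ∀ x m, P x m ≤ 1)
    {δ : ℝ} (hδ : 0 ≤ δ) {L : ℕ} (hL : 0 < L)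
    (hdist : ∀ x y, (#{j | x j = y j} : ℝ) < (1 / 2 + δ) * n →
      ∃ g : M → ℝ, (∀ m, |g m| ≤ 1) ∧ 1 / (L : ℝ) ≤ ∑ m, (P x m - P y m) * g m) :
    Real.exp (2 * δ ^ 2 * n) ≤ ((L * Fintype.card M + 1) ^ Fintype.card M : ℕ) := by
  classical
  by_contra! hlt
  -- With mesh `1 / K`, equal roundings cost less than `1 / K` per message, hence less than `1 / L`
  -- in total. Probability `1` needs the extra value `K`.
  set K : ℕ := L * Fintype.card M with hK
  have hKpos : (0 : ℝ) < K := by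
    have : 0 < K := Nat.mul_pos hL Fintype.card_pos
    exact_mod_cast this
  have hfl : ∀ x m, ⌊(K : ℝ) * P x m⌋₊ < K + 1 := fun x m =>
    Nat.lt_succ_of_le (Nat.floor_le_of_le (by nlinarith [hP1 x m]))
  obtain ⟨x, y, hxy, hagree⟩ := exists_same_colour_few_agreements
    (fun x => (fun m => ⟨⌊(K : ℝ) * P x m⌋₊, hfl x m⟩ : M → Fin (K + 1))) hδ (by simpa using hlt)
  obtain ⟨g, hg, hadv⟩ := hdist x y hagree
  have hclose : ∀ m, (P x m - P y m) * g m < 1 / K := by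
    intro m
    have h1 : ⌊(K : ℝ) * P x m⌋₊ = ⌊(K : ℝ) * P y m⌋₊ := by
      simpa using congrFun hxy m
    have h2 := Nat.floor_le (mul_nonneg hKpos.le (hP x m))
    have h3 := Nat.floor_le (mul_nonneg hKpos.le (hP y m))
    have h4 := Nat.lt_floor_add_one ((K : ℝ) * P x m)
    have h5 := Nat.lt_floor_add_one ((K : ℝ) * P y m)
    rw [h1] at h2 h4
    have h6 : |P x m - P y m| < 1 / K := by
      rw [lt_div_iff₀ hKpos, ← abs_of_pos hKpos, ← abs_mul, abs_lt]
      constructor <;> linarith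
    calc (P x m - P y m) * g m ≤ |P x m - P y m| * |g m| := by
          rw [← abs_mul]
          exact le_abs_self _
      _ ≤ |P x m - P y m| * 1 := by gcongr; exact hg m
      _ < 1 / K := by rwa [mul_one]
  have hsum : ∑ m, (P x m - P y m) * g m < ∑ _m : M, 1 / (K : ℝ) :=
    sum_lt_sum_of_nonempty univ_nonempty fun m _ => hclose m
  rw [sum_const, nsmul_eq_mul, card_univ, hK, Nat.cast_mul, mul_one_div] at hsum
  have hM : (Fintype.card M : ℝ) ≠ 0 := by exact_mod_cast Fintype.card_ne_zero
  have : (Fintype.card M : ℝ) / (L * Fintype.card M) = 1 / L := by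
    rw [mul_comm, div_mul_eq_div_div, div_self hM]
  linarith

/-! ### Streams made of consecutive blocks -/

/-- The interval `[i t / n, (i + 1) t / n]`. -/
noncomputable def block (n t i : ℕ) : NonemptyInterval ℝ :=
  ⟨(((i * t : ℕ) : ℝ) / n, (((i + 1) * t : ℕ) : ℝ) / n), by
    dsimp only
    gcongr
    exact Nat.le_succ i⟩

/-- The stream of the blocks with numbers in `S`. -/
noncomputable def blocks (n t : ℕ) {N : ℕ} (S : Finset (Fin N)) : IntervalStream :=
  S.toList.map fun i : Fin N => block n t i.val

lemma length_blocks_le (n t : ℕ) {N : ℕ} (S : Finset (Fin N)) : (blocks n t S).length ≤ N := by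
  simpa [blocks] using card_le_univ S

lemma hasCoordsIn_blocks {n t N : ℕ} {U : Set ℝ} (hU : ∀ i : ℕ, i ≤ n → (i : ℝ) / (n : ℝ) ∈ U)
    (hN : N * t ≤ n) (S : Finset (Fin N)) : HasCoordsIn (blocks n t S) U := by
  intro I hI
  obtain ⟨i, -, rfl⟩ := List.mem_map.1 hI
  have h : (i.val + 1) * t ≤ n := (Nat.mul_le_mul_right t i.isLt).trans hN
  exact ⟨hU _ ((Nat.mul_le_mul_right t (Nat.le_succ _)).trans h), hU _ h⟩

lemma HasCoordsIn.append {σ τ : IntervalStream} {U : Set ℝ} (hσ : HasCoordsIn σ U)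
    (hτ : HasCoordsIn τ U) : HasCoordsIn (σ ++ τ) U := fun I hI =>
  (List.mem_append.1 hI).elim (hσ I) (hτ I)

lemma covered_blocks_append (n t : ℕ) {N : ℕ} (S T : Finset (Fin N)) :
    covered (blocks n t S ++ blocks n t T)
      = ⋃ i ∈ S ∪ T, Set.Icc (block n t i).fst (block n t i).snd := by
  ext v
  simp only [covered, blocks, List.mem_append, List.mem_map, mem_toList, Set.mem_iUnion, mem_union,
    exists_prop]
  constructor
  · rintro ⟨_, ⟨i, hi, rfl⟩ | ⟨i, hi, rfl⟩, hv⟩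
    exacts [⟨i, Or.inl hi, hv⟩, ⟨i, Or.inr hi, hv⟩]
  · rintro ⟨i, hi | hi, hv⟩
    exacts [⟨_, Or.inl ⟨i, hi, rfl⟩, hv⟩, ⟨_, Or.inr ⟨i, hi, rfl⟩, hv⟩]

/-- Distinct blocks share at most an end point. -/
lemma aedisjoint_block (n t : ℕ) {i j : ℕ} (hij : i < j) :
    AEDisjoint volume (Set.Icc (block n t i).fst (block n t i).snd)
      (Set.Icc (block n t j).fst (block n t j).snd) := by
  have h : (block n t i).snd ≤ (block n t j).fst := by
    simp only [block]
    gcongr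
    exact hij
  refine measure_mono_null (t := {(block n t i).snd}) ?_ (by simp)
  rintro v ⟨hv1, hv2⟩
  exact le_antisymm hv1.2 (h.trans hv2.1)

lemma kleeMeasure_blocks_append (n t : ℕ) {N : ℕ} (S T : Finset (Fin N)) :
    kleeMeasure (blocks n t S ++ blocks n t T) = #(S ∪ T) * ((t : ℝ) / n) := by
  have hvol : ∀ i : ℕ, volume (Set.Icc (block n t i).fst (block n t i).snd)
      = ENNReal.ofReal ((t : ℝ) / n) := by
    intro i
    rw [Real.volume_Icc]
    congr 1
    simp only [block]
    push_cast
    ring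
  rw [kleeMeasure, covered_blocks_append, measureReal_def, measure_biUnion_finset₀ ?_
    fun i _ => measurableSet_Icc.nullMeasurableSet]
  · simp only [hvol, sum_const, nsmul_eq_mul, ENNReal.toReal_mul, ENNReal.toReal_natCast]
    rw [ENNReal.toReal_ofReal (by positivity)]
  · intro i _ j _ hij
    rcases lt_or_gt_of_ne (Fin.val_ne_of_ne hij) with h | h
    · exact aedisjoint_block n t h
    · exact (aedisjoint_block n t h).symm

/-! ### Cutting a run of the algorithm in two -/

namespace StreamAlg

variable {s : ℕ}

/-- The algorithm started from a given memory contents. -/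
noncomputable def startAt (A : StreamAlg s) (m : Memory s) : StreamAlg s :=
  { A with init := PMF.pure m }

/-- Markov property: the rest of the run depends on the past only through the current memory. -/
lemma foldl_bind_step (A : StreamAlg s) (σ : IntervalStream) (μ : PMF (Memory s)) :
    σ.foldl (fun μ I => μ.bind fun m => A.step m I) μ
      = μ.bind fun m => (A.startAt m).memoryLaw σ := by
  induction σ generalizing μ with
  | nil => simp [memoryLaw, startAt]
  | cons I σ ih =>
    rw [List.foldl_cons, ih, PMF.bind_bind]
    congr 1
    funext m
    rw [memoryLaw, List.foldl_cons]
    simp only [startAt, PMF.pure_bind]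
    exact (ih _).symm

lemma memoryLaw_append (A : StreamAlg s) (σ τ : IntervalStream) :
    A.memoryLaw (σ ++ τ) = (A.memoryLaw σ).bind fun m => (A.startAt m).memoryLaw τ := by
  rw [memoryLaw, List.foldl_append, foldl_bind_step]
  rfl

instance isProbabilityMeasure_answerLaw (A : StreamAlg s) (σ : IntervalStream) :
    IsProbabilityMeasure (A.answerLaw σ) := by
  constructor
  simp only [answerLaw, Measure.coe_finsetSum, Finset.sum_apply, Measure.smul_apply, measure_univ,
    smul_eq_mul, mul_one]
  simpa only [tsum_fintype] using (A.memoryLaw σ).tsum_coe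

/-- The probability of a memory contents after a stream, as a real number. -/
noncomputable def memoryProb (A : StreamAlg s) (σ : IntervalStream) (m : Memory s) : ℝ :=
  (A.memoryLaw σ m).toReal

lemma memoryProb_nonneg (A : StreamAlg s) (σ : IntervalStream) (m : Memory s) :
    0 ≤ A.memoryProb σ m := ENNReal.toReal_nonneg

lemma sum_memoryProb (A : StreamAlg s) (σ : IntervalStream) : ∑ m, A.memoryProb σ m = 1 := by
  simp only [memoryProb]
  have h := (A.memoryLaw σ).tsum_coe
  rw [tsum_fintype] at h
  rw [← ENNReal.toReal_sum fun m _ => PMF.apply_ne_top _ m, h, ENNReal.toReal_one]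

lemma memoryProb_le_one (A : StreamAlg s) (σ : IntervalStream) (m : Memory s) :
    A.memoryProb σ m ≤ 1 := by
  rw [← A.sum_memoryProb σ]
  exact single_le_sum (fun m _ => A.memoryProb_nonneg σ m) (mem_univ m)

lemma answerLaw_append_real (A : StreamAlg s) (σ τ : IntervalStream) (E : Set ℝ) :
    (A.answerLaw (σ ++ τ)).real E
      = ∑ m, A.memoryProb σ m * ((A.startAt m).answerLaw τ).real E := by
  have h : A.answerLaw (σ ++ τ) E
      = ∑ m, A.memoryLaw σ m * (A.startAt m).answerLaw τ E := by
    simp only [answerLaw, Measure.coe_finsetSum, Finset.sum_apply, Measure.smul_apply, smul_eq_mul,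
      memoryLaw_append, PMF.bind_apply, tsum_fintype, sum_mul, mul_sum]
    rw [sum_comm]
    simp only [mul_assoc]
    rfl
  rw [measureReal_def, h, ENNReal.toReal_sum]
  · simp only [ENNReal.toReal_mul]
    rfl
  · exact fun m _ => ENNReal.mul_ne_top (PMF.apply_ne_top _ m) (measure_ne_top _ _)

/-- The answers within `ε` of `a`. -/
def near (ε a : ℝ) : Set ℝ := {v | |v - a| ≤ ε}

lemma measurableSet_near (ε a : ℝ) : MeasurableSet (near ε a) :=
  measurableSet_le (by fun_prop) measurable_const

/-- The two windows of answers are disjoint. -/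
lemma real_near_add_le (μ : Measure ℝ) [IsProbabilityMeasure μ] {ε a b : ℝ}
    (hab : 2 * ε < b - a) : μ.real (near ε a) + μ.real (near ε b) ≤ 1 := by
  rw [← measureReal_union _ (measurableSet_near ε b)]
  · exact measureReal_le_one
  · refine Set.disjoint_left.2 fun v (h1 : |v - a| ≤ ε) (h2 : |v - b| ≤ ε) => ?_
    rw [abs_le] at h1 h2
    linarith

lemma IsAdditiveSolution.le_real {A : StreamAlg s} {ε ρ : ℝ} {k : ℕ} {U : Set ℝ}
    (hA : A.IsAdditiveSolution ε ρ k U) {σ : IntervalStream} (hk : σ.length ≤ k)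
    (hσ : HasCoordsIn σ U) {a : ℝ} (ha : kleeMeasure σ = a) :
    1 - ρ ≤ (A.answerLaw σ).real (near ε a) := by
  subst ha
  exact (ENNReal.ofReal_le_iff_le_toReal (measure_ne_top _ _)).1 (hA σ hk hσ)

lemma IsAdditiveSolution.le_sum_blocks {A : StreamAlg s} {ε ρ : ℝ} {n t N : ℕ} {U : Set ℝ}
    (hA : A.IsAdditiveSolution ε ρ (2 * n) U) (hU : ∀ i : ℕ, i ≤ n → (i : ℝ) / (n : ℝ) ∈ U)
    (hN : N * t ≤ n) (ht : 0 < t) (S T : Finset (Fin N)) {a : ℝ}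
    (ha : #(S ∪ T) * ((t : ℝ) / n) = a) :
    1 - ρ ≤ ∑ m, A.memoryProb (blocks n t S) m *
      ((A.startAt m).answerLaw (blocks n t T)).real (near ε a) := by
  rw [← answerLaw_append_real]
  refine hA.le_real ?_ ((hasCoordsIn_blocks hU hN S).append (hasCoordsIn_blocks hU hN T))
    ((kleeMeasure_blocks_append n t S T).trans ha)
  have h : N ≤ n := (Nat.le_mul_of_pos_right N ht).trans hN
  have h1 := length_blocks_le n t S
  have h2 := length_blocks_le n t T
  rw [List.length_append]
  omega

/-! ### The two lower bounds -/

/-- The blocks that a Boolean vector selects. -/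
def selected {N : ℕ} (x : Fin N → Bool) : Finset (Fin N) := {j | x j = true}

/-- Only block `j` can be missing from the union, so one bit decides the measure. -/
lemma card_selected_union_erase {N : ℕ} (x : Fin N → Bool) (j : Fin N) :
    (#(selected x ∪ univ.erase j) : ℝ) = if x j then (N : ℝ) else N - 1 := by
  have hN : 1 ≤ N := j.pos
  split_ifs with hx
  · have : selected x ∪ univ.erase j = univ := by
      ext i
      by_cases hi : i = j <;> simp [selected, hi, hx]
    rw [this, card_univ, Fintype.card_fin]
  · have : selected x ∪ univ.erase j = univ.erase j := by
      ext i
      by_cases hi : i = j <;> simp [selected, hi, hx]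
    rw [this, card_erase_of_mem (mem_univ j), card_univ, Fintype.card_fin, Nat.cast_sub hN,
      Nat.cast_one]

/-- The memory must allow to recover each of `N` bits, by the blocks of length `t / n > 2 ε`. -/
lemma IsAdditiveSolution.exp_blocks_le {A : StreamAlg s} {ε ρ : ℝ} {n t N : ℕ} {U : Set ℝ}
    (hA : A.IsAdditiveSolution ε ρ (2 * n) U) (hρ : ρ < 1 / 2)
    (hU : ∀ i : ℕ, i ≤ n → (i : ℝ) / (n : ℝ) ∈ U)
    (hN : N * t ≤ n) (ht : 0 < t) (hε : 2 * ε < (t : ℝ) / n) :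
    Real.exp (2 * (1 / 2 - ρ) ^ 2 * N) ≤ 2 ^ s := by
  -- The decoder resumes the run from `m`, reads every block but the `j`-th, and tests whether the
  -- answer fits bit `b`.
  have h := exp_le_card_of_recover (fun x => A.memoryProb (blocks n t (selected x)))
    (fun x => A.memoryProb_nonneg _) (fun x => A.sum_memoryProb _)
    (fun m (j : Fin N) b => ((A.startAt m).answerLaw (blocks n t (univ.erase j))).real
      (near ε ((if b then (N : ℝ) else N - 1) * ((t : ℝ) / n))))
    (fun m j b => measureReal_nonneg) (fun m j => ?_) (δ := 1 / 2 - ρ) (by linarith)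
    (fun x j => ?_)
  · simpa using h
  · rw [add_comm]
    refine real_near_add_le _ ?_
    simp only [if_true, Bool.false_eq_true, if_false]
    linarith
  · refine le_trans (by linarith) (hA.le_sum_blocks hU hN ht (selected x) (univ.erase j) ?_)
    rw [card_selected_union_erase]

lemma card_agree_add_card_sdiff {n : ℕ} (x y : Fin n → Bool) :
    #{j | x j = y j} + (#(selected x \ selected y) + #(selected y \ selected x)) = n := by
  rw [← card_union_of_disjoint, ← card_union_of_disjoint]
  · conv_rhs => rw [← Fintype.card_fin n, ← card_univ]
    congr 1
    ext j
    cases hx : x j <;> cases hy : y j <;> simp [selected, hx, hy]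
  · refine disjoint_left.2 fun j => ?_
    cases hx : x j <;> cases hy : y j <;> simp [selected, hx, hy]
  · refine disjoint_left.2 fun j => ?_
    cases hx : x j <;> cases hy : y j <;> simp [selected, hx, hy]

/-- The test is the chance of answering near `b`, the measure of the union, once the blocks of `y`
are appended: at least `1 - ρ` on average after `x`, at most `ρ` after `y`. -/
lemma IsAdditiveSolution.exists_test {A : StreamAlg s} {ε ρ : ℝ} {n : ℕ} {U : Set ℝ}
    (hA : A.IsAdditiveSolution ε ρ (2 * n) U)
    (hU : ∀ i : ℕ, i ≤ n → (i : ℝ) / (n : ℝ) ∈ U) (hn : 0 < n) (x y : Fin n → Bool)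
    (hxy : 2 * ε * n < #(selected x \ selected y)) :
    ∃ g : Memory s → ℝ, (∀ m, |g m| ≤ 1) ∧ 1 - 2 * ρ ≤
      ∑ m, (A.memoryProb (blocks n 1 (selected x)) m -
        A.memoryProb (blocks n 1 (selected y)) m) * g m := by
  have hn' : (0 : ℝ) < n := by exact_mod_cast hn
  set a : ℝ := #(selected y ∪ selected y) * (((1 : ℕ) : ℝ) / n) with ha
  set b : ℝ := #(selected x ∪ selected y) * (((1 : ℕ) : ℝ) / n) with hb
  have hab : 2 * ε < b - a := by
    have h : (#(selected x ∪ selected y) : ℝ)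
        = #(selected x \ selected y) + #(selected y) := by
      exact_mod_cast (card_sdiff_add_card (selected x) (selected y)).symm
    rw [ha, hb, h, union_self, ← sub_mul, add_sub_cancel_right, Nat.cast_one, mul_one_div,
      lt_div_iff₀ hn']
    exact hxy
  have hx := hA.le_sum_blocks hU (by omega) one_pos (selected x) (selected y) hb.symm
  have hy := hA.le_sum_blocks hU (by omega) one_pos (selected y) (selected y) ha.symm
  refine ⟨fun m => ((A.startAt m).answerLaw (blocks n 1 (selected y))).real (near ε b),
    fun m => ?_, ?_⟩
  · rw [abs_of_nonneg measureReal_nonneg]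
    exact measureReal_le_one
  · have hy' := real_near_add_le (A.answerLaw (blocks n 1 (selected y) ++ blocks n 1 (selected y)))
      hab
    simp only [answerLaw_append_real] at hy'
    simp only [sub_mul, sum_sub_distrib]
    linarith

/-- Distinct codewords must lead to distinguishable memory laws. -/
lemma IsAdditiveSolution.exp_le_pow {A : StreamAlg s} {ε ρ : ℝ} {n : ℕ} {U : Set ℝ}
    (hA : A.IsAdditiveSolution ε ρ (2 * n) U)
    (hU : ∀ i : ℕ, i ≤ n → (i : ℝ) / (n : ℝ) ∈ U) (hn : 0 < n) (hε : ε < 0.1)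
    {L : ℕ} (hL : 0 < L) (hLρ : 1 / (L : ℝ) ≤ 1 - 2 * ρ) :
    Real.exp (2 * 0.08 ^ 2 * n) ≤ ((L * 2 ^ s + 1) ^ 2 ^ s : ℕ) := by
  have hn' : (0 : ℝ) < n := by exact_mod_cast hn
  have h := exp_le_of_distinguish (fun x : Fin n → Bool => A.memoryProb (blocks n 1 (selected x)))
    (fun x => A.memoryProb_nonneg _) (fun x => A.memoryProb_le_one _) (δ := 0.08) (by norm_num) hL
    fun x y hxy => ?_
  · simpa using h
  have hcard : (#{j | x j = y j} : ℝ)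
      + (#(selected x \ selected y) + #(selected y \ selected x)) = n := by
    exact_mod_cast card_agree_add_card_sdiff x y
  have hεn : ε * n < 0.1 * n := mul_lt_mul_of_pos_right hε hn'
  -- Fewer than `0.58 n` agreements leave more than `0.42 n` differences, so one of the two set
  -- differences exceeds `0.21 n > 2 ε n`. In the second case the roles swap and the test changes
  -- sign.
  rcases lt_or_ge (2 * ε * n) (#(selected x \ selected y) : ℝ) with hlt | hle
  · obtain ⟨g, hg, hadv⟩ := hA.exists_test hU hn x y hlt
    exact ⟨g, hg, hLρ.trans hadv⟩
  · obtain ⟨g, hg, hadv⟩ := hA.exists_test hU hn y x (by linarith)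
    refine ⟨fun m => -g m, fun m => by rw [abs_neg]; exact hg m,
      (hLρ.trans hadv).trans_eq (sum_congr rfl fun m _ => by ring)⟩

lemma IsAdditiveSolution.one_div_le {A : StreamAlg s} {ε ρ : ℝ} {n : ℕ} {U : Set ℝ}
    (hA : A.IsAdditiveSolution ε ρ (2 * n) U) (hρ : ρ < 1 / 2)
    (hU : ∀ i : ℕ, i ≤ n → (i : ℝ) / (n : ℝ) ∈ U) (hε₀ : 0 < ε) (hε : ε < 0.1)
    (hn : 1 / 4 ≤ ε * n) :
    1 / ε ≤ 6 / (1 / 2 - ρ) ^ 2 * s := by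
  have hδ : 0 < 1 / 2 - ρ := by linarith
  have hn2 : (2 : ℝ) < n := by nlinarith
  have hn' : (0 : ℝ) < n := by linarith
  -- The least `t` with `t / n > 2 ε`; `1 ≤ 4 ε n` keeps it below `6 ε n`, so `n / t` blocks are of
  -- order `1 / ε`.
  set t : ℕ := ⌊2 * ε * n⌋₊ + 1 with ht
  have ht1 : 2 * ε * n < t := by
    rw [ht]
    push_cast
    exact Nat.lt_floor_add_one _
  have ht2 : (t : ℝ) ≤ 2 * ε * n + 1 := by
    rw [ht]
    push_cast
    linarith [Nat.floor_le (show 0 ≤ 2 * ε * n by positivity)]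
  have htpos : 0 < t := Nat.succ_pos _
  have ht0 : (0 : ℝ) < t := by exact_mod_cast htpos
  have htn : t ≤ n := by
    have : (t : ℝ) ≤ n := by nlinarith
    exact_mod_cast this
  have hN : (n : ℝ) ≤ 2 * t * (n / t : ℕ) := by
    have h1 : n < t * (n / t) + t := by
      have := Nat.div_add_mod n t
      have := Nat.mod_lt n htpos
      omega
    have h2 : 1 ≤ n / t := Nat.div_pos htn htpos
    have h3 : n ≤ 2 * t * (n / t) := by nlinarith
    exact_mod_cast h3
  have hexp := hA.exp_blocks_le hρ hU (Nat.div_mul_le_self n t) htpos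
    ((lt_div_iff₀ hn').2 ht1)
  have hs : 2 * (1 / 2 - ρ) ^ 2 * (n / t : ℕ) ≤ s := by
    have h1 : (2 : ℝ) ^ s ≤ Real.exp s := by
      rw [← Real.exp_one_pow]
      exact pow_le_pow_left₀ (by norm_num) (by linarith [Real.add_one_le_exp 1]) s
    exact Real.exp_le_exp.1 (hexp.trans h1)
  have hN12 : 1 ≤ 12 * ε * (n / t : ℕ) := by
    have h1 : (t : ℝ) ≤ 6 * ε * n := by linarith
    have h2 : (n : ℝ) ≤ 2 * (6 * ε * n) * (n / t : ℕ) := hN.trans (by gcongr)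
    have h3 : 1 * (n : ℝ) ≤ 12 * ε * (n / t : ℕ) * n := by linarith
    exact le_of_mul_le_mul_right h3 hn'
  rw [div_mul_eq_mul_div, div_le_div_iff₀ hε₀ (by positivity)]
  calc 1 * (1 / 2 - ρ) ^ 2 ≤ 12 * ε * (n / t : ℕ) * (1 / 2 - ρ) ^ 2 := by gcongr
    _ = 6 * (2 * (1 / 2 - ρ) ^ 2 * (n / t : ℕ)) * ε := by ring
    _ ≤ 6 * s * ε := by gcongr

lemma IsAdditiveSolution.logb_le {A : StreamAlg s} {ε ρ : ℝ} {n : ℕ} {U : Set ℝ}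
    (hA : A.IsAdditiveSolution ε ρ (2 * n) U)
    (hU : ∀ i : ℕ, i ≤ n → (i : ℝ) / (n : ℝ) ∈ U) (hn : 0 < n) (hε : ε < 0.1)
    {L : ℕ} (hL : 0 < L) (hLρ : 1 / (L : ℝ) ≤ 1 - 2 * ρ) :
    Real.logb 2 n ≤ Real.logb 2 (79 * L) + 2 * s := by
  have hn' : (0 : ℝ) < n := by exact_mod_cast hn
  have hL' : (0 : ℝ) < L := by exact_mod_cast hL
  have hexp := hA.exp_le_pow hU hn hε hL hLρ
  have hpow : (((L * 2 ^ s + 1) ^ 2 ^ s : ℕ) : ℝ) ≤ Real.exp (2 ^ s * (L * 2 ^ s)) := by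
    have h := Real.exp_nat_mul ((L : ℝ) * 2 ^ s) (2 ^ s)
    push_cast at h ⊢
    rw [h]
    exact pow_le_pow_left₀ (by positivity) (Real.add_one_le_exp _) _
  -- The constant comes from `1 / (2 * 0.08 ^ 2) = 78.125 < 79`.
  have hle : (n : ℝ) ≤ 79 * L * 2 ^ (2 * s) := by
    have h := Real.exp_le_exp.1 (hexp.trans hpow)
    rw [two_mul s, pow_add]
    have : 0 ≤ (2 : ℝ) ^ s * (L * 2 ^ s) := by positivity
    linarith
  calc Real.logb 2 n ≤ Real.logb 2 (79 * L * 2 ^ (2 * s)) :=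
        Real.logb_le_logb_of_le one_lt_two hn' hle
    _ = Real.logb 2 (79 * L) + 2 * s := by
        rw [Real.logb_mul (by positivity) (by positivity), Real.logb_pow,
          Real.logb_self_eq_one one_lt_two]
        push_cast
        ring

end StreamAlg

end KleeStream

theorem mainTheorem1 (ρ : ℝ) (hρ₀ : 0 ≤ ρ) (hρ : ρ < 1 / 2) :
    ∃ c : ℝ, 0 < c ∧ ∀ ε : ℝ, 0 < ε → ε < 0.1 →
      ∃ n₀ : ℕ, 0 < n₀ ∧ (n₀ : ℝ) ≤ 1 / (2 * ε) ∧
        ∀ n : ℕ, n₀ ≤ n →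
          ∀ U : Set ℝ, (∀ i : ℕ, i ≤ n → (i : ℝ) / (n : ℝ) ∈ U) →
            ∀ (s : ℕ) (A : KleeStream.StreamAlg s), A.IsAdditiveSolution ε ρ (2 * n) U →
              c * (1 / ε + Real.logb 2 (n : ℝ)) ≤ (s : ℝ) := by
  have hδ : 0 < 1 - 2 * ρ := by linarith
  have hδ' : 0 < 1 / 2 - ρ := by linarith
  obtain ⟨k, hk⟩ := exists_nat_one_div_lt hδ
  set L : ℕ := k + 1 with hLdef
  have hL : 0 < L := Nat.succ_pos k
  have hLρ : 1 / (L : ℝ) ≤ 1 - 2 * ρ := by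
    rw [hLdef]
    push_cast
    exact hk.le
  have hlog : 0 ≤ Real.logb 2 (79 * L) := by
    have : (1 : ℝ) ≤ L := by exact_mod_cast hL
    exact Real.logb_nonneg one_lt_two (by linarith)
  set C : ℝ := 6 / (1 / 2 - ρ) ^ 2 + (Real.logb 2 (79 * L) + 2) with hC
  have hCpos : 0 < C := by positivity
  refine ⟨1 / C, by positivity, fun ε hε₀ hε => ?_⟩
  have h5 : 5 ≤ 1 / (2 * ε) := by
    rw [le_div_iff₀ (by positivity)]
    linarith
  refine ⟨⌊1 / (2 * ε)⌋₊, Nat.floor_pos.2 (by linarith), Nat.floor_le (by linarith),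
    fun n hn U hU s A hA => ?_⟩
  have hn4 : 1 / 4 ≤ ε * n := by
    have h1 : 1 / (2 * ε) < n + 1 :=
      (Nat.lt_floor_add_one _).trans_le (by exact_mod_cast Nat.succ_le_succ hn)
    rw [div_lt_iff₀ (by positivity)] at h1
    linarith
  have hnpos : 0 < n := (Nat.floor_pos.2 (by linarith)).trans_le hn
  have hidx := hA.one_div_le hρ hU hε₀ hε hn4
  have heq := hA.logb_le hU hnpos hε hL hLρ
  -- A memory of zero bits is excluded by the first bound; `1 ≤ s` lets the additive constant `logb
  -- 2 (79 * L)` be absorbed into a multiple of `s`.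
  have hs : (1 : ℝ) ≤ s := by
    have : s ≠ 0 := by
      rintro rfl
      have : 0 < 1 / ε := by positivity
      simp only [Nat.cast_zero, mul_zero] at hidx
      linarith
    exact_mod_cast Nat.one_le_iff_ne_zero.2 this
  rw [one_div_mul_eq_div, div_le_iff₀ hCpos, hC]
  nlinarith [mul_le_mul_of_nonneg_left hs hlog]
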